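/- Let $J^k=J^k(\mathbb R^2,\mathbb R)$ be the space of $k$-jets of functions $u(x,y)$, with coordinates $x,y$ and $u_\sigma$, $|\sigma|\le k$, and let the Cartan distribution of $J^3$ be the common kernel of the contact forms $du_\sigma-u_{\sigma x}\,dx-u_{\sigma y}\,dy$, $|\sigma|\le 2$. A (local) contact transformation of $J^3$ is a $C^\infty$ diffeomorphism between two open subsets of $J^3$ whose differential maps the Cartan distribution onto the Cartan distribution. A quasi-linear third-order PDE is a set $\mathcal F\subseteq J^3$ of the form $$a_0u_{xxx}+a_1u_{xxy}+a_2u_{xyy}+a_3u_{yyy}+b=0$$ with $a_0,\dots,a_3,b$ smooth functions on an open subset $W$ of $J^2$ (so $\mathcal F$ lies over $W$; the $a_i$ may vanish). The third-order PDE $$\mathcal E=\{u_{xxy}u_{yyy}-u_{xyy}^2=0\}\subseteq J^3$$ is not contact-equivalent to a quasi-linear PDE, not even locally: there are no quasi-linear PDE $\mathcal F$ and no contact transformation $\Phi:U\to V$ between open subsets $U,V\subseteq J^3$ with $U\cap\mathcal E\neq\emptyset$ such that $\Phi(U\cap\mathcal E)=V\cap\mathcal F$. -/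

import Mathlib

open scoped ContDiff

namespace JetPDE

/-- Coordinates `(x, y)` and `u` of `J⁰(ℝ², ℝ)`, i.e. of `ℝ³`. -/
abbrev J0 : Type := (Fin 2 → ℝ) × (Fin 1 → ℝ)

/-- First jets: append `(u_x, u_y)`. -/
abbrev J1 : Type := J0 × (Fin 2 → ℝ)

/-- Second jets: append `(u_xx, u_xy, u_yy)`. -/
abbrev J2 : Type := J1 × (Fin 3 → ℝ)

/-- Third jets: append `(u_xxx, u_xxy, u_xyy, u_yyy)`.
In every order `r` the entry with index `j` is the coordinate of `∂^r u / ∂x^(r-j) ∂y^j`. -/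
abbrev J3 : Type := J2 × (Fin 4 → ℝ)

/-- The independent variables; on a tangent vector, its components along `∂_x, ∂_y`. -/
def base (p : J3) : Fin 2 → ℝ := p.1.1.1.1

/-- The dependent variable `u`. -/
def ord0 (p : J3) : Fin 1 → ℝ := p.1.1.1.2

/-- The derivatives `(u_x, u_y)`. -/
def ord1 (p : J3) : Fin 2 → ℝ := p.1.1.2

/-- The derivatives `(u_xx, u_xy, u_yy)`. -/
def ord2 (p : J3) : Fin 3 → ℝ := p.1.2

/-- The derivatives `(u_xxx, u_xxy, u_xyy, u_yyy)`. -/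
def ord3 (p : J3) : Fin 4 → ℝ := p.2

/-- The projection `J³ → J²`. -/
def proj (p : J3) : J2 := p.1

/-- The Cartan plane of `J³` at `p`: the common kernel of the contact forms
`du_σ - u_{σx} dx - u_{σy} dy`, where `σ` runs over the multi-indices of order `0, 1, 2`.
The tangent space of `J³` at `p` is identified with `J³`. -/
def cartan (p : J3) : Submodule ℝ J3 where
  carrier := {v |
    (∀ j : Fin 1, ord0 v j = ord1 p j.castSucc * base v 0 + ord1 p j.succ * base v 1) ∧
    (∀ j : Fin 2, ord1 v j = ord2 p j.castSucc * base v 0 + ord2 p j.succ * base v 1) ∧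
    (∀ j : Fin 3, ord2 v j = ord3 p j.castSucc * base v 0 + ord3 p j.succ * base v 1)}
  zero_mem' := by simp [ord0, ord1, ord2, base]
  add_mem' := by
    rintro v w ⟨h0, h1, h2⟩ ⟨k0, k1, k2⟩
    simp only [ord0, ord1, ord2, base, Set.mem_ofPred_eq, Prod.fst_add, Prod.snd_add,
      Pi.add_apply] at *
    refine ⟨fun j => ?_, fun j => ?_, fun j => ?_⟩
    · rw [h0, k0]; ring
    · rw [h1, k1]; ring
    · rw [h2, k2]; ring
  smul_mem' := by
    rintro c v ⟨h0, h1, h2⟩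
    simp only [ord0, ord1, ord2, base, Set.mem_ofPred_eq, Prod.smul_fst, Prod.smul_snd,
      Pi.smul_apply, smul_eq_mul] at *
    refine ⟨fun j => ?_, fun j => ?_, fun j => ?_⟩
    · rw [h0]; ring
    · rw [h1]; ring
    · rw [h2]; ring

/-- A (local) contact transformation of `J³`: a smooth diffeomorphism between two open subsets,
`Φ.source` and `Φ.target`, whose differential carries Cartan planes onto Cartan planes. -/
structure IsContactTransformation (Φ : OpenPartialHomeomorph J3 J3) : Prop where
  contDiffOn : ContDiffOn ℝ ∞ Φ Φ.source
  contDiffOn_symm : ContDiffOn ℝ ∞ Φ.symm Φ.target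
  map_cartan : ∀ p ∈ Φ.source,
    (cartan p).map (fderiv ℝ Φ p : J3 →ₗ[ℝ] J3) = cartan (Φ p)

/-- Two equations are contact equivalent around some point of the first: a contact transformation,
defined on an open set which meets `E` (possibly on all of `J³`), carries `E` to `F`. -/
def ContactEquivalent (E F : Set J3) : Prop :=
  ∃ Φ : OpenPartialHomeomorph J3 J3, IsContactTransformation Φ ∧
    (Φ.source ∩ E).Nonempty ∧ Φ '' (Φ.source ∩ E) = Φ.target ∩ F

/-- A quasi-linear equation: `a₀ u_xxx + a₁ u_xxy + a₂ u_xyy + a₃ u_yyy + b = 0`, where the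
coefficients are smooth functions on an open set `W` of second jets. The symbol `(a₀, …, a₃)` is
allowed to vanish. -/
def IsQuasiLinear (F : Set J3) : Prop :=
  ∃ (W : Set J2) (a : Fin 4 → J2 → ℝ) (b : J2 → ℝ), IsOpen W ∧
    (∀ j, ContDiffOn ℝ ∞ (a j) W) ∧ ContDiffOn ℝ ∞ b W ∧
    F = {p | proj p ∈ W ∧ ∑ j, a j (proj p) * ord3 p j + b (proj p) = 0}

/-- The equation `u_xxy u_yyy - u_xyy² = 0`. -/
def equationE : Set J3 := {p | ord3 p 1 * ord3 p 3 - ord3 p 2 ^ 2 = 0}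

end JetPDE

/-! A contact transformation of $J^3$ locally maps fibres of $J^3\to J^2$ to fibres and is affine on
them. A quasi-linear equation meets each fibre in a set closed under midpoints, whereas near each of
its points the quadratic cone $\mathcal E$ has two points in one fibre whose midpoint lies off
$\mathcal E$; hence no equivalence exists.

The fibre statement comes from curvature. The curvature of the Cartan distribution generates the
derived distribution, which is therefore preserved (`memDerived_fderiv`). The curvature of the
latter distinguishes vertical directions: pairing with a rank-one second-order vector has values in
a line, while pairing with a non-vertical vector fills a plane. So vectors vertical over $J^1$ have
images with zero base part (`base_fderiv_eq_zero`), and fibres over $J^2$ are preserved. Affineness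
(`ord3_midpoint`) follows because Cartan planes depend affinely on the third-order coordinates. -/

namespace JetPDE

/-! ### Curvature of a distribution under a smooth map -/

/-- Second-order consequence of preserving the kernel of `w ↦ τ w - β p w`: the curvature
`(v, w) ↦ β v w - β w v` is preserved up to the induced map on the quotient. -/
theorem curvature_map {E G : Type*} [NormedAddCommGroup E] [NormedSpace ℝ E]
    [NormedAddCommGroup G] [NormedSpace ℝ G]
    (τ : E →L[ℝ] G) (β : E →L[ℝ] E →L[ℝ] G) (s : G →L[ℝ] E)
    (hτ : ∀ g, τ (s g) = g) (hβ : ∀ p g, β p (s g) = 0)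
    {Φ : E → E} {U : Set E} (hU : IsOpen U) (hΦ : ContDiffOn ℝ ∞ Φ U)
    (hker : ∀ p ∈ U, ∀ w, τ w = β p w → τ (fderiv ℝ Φ p w) = β (Φ p) (fderiv ℝ Φ p w))
    {p : E} (hp : p ∈ U) {v w : E} (hv : τ v = β p v) (hw : τ w = β p w) :
    β (fderiv ℝ Φ p v) (fderiv ℝ Φ p w) - β (fderiv ℝ Φ p w) (fderiv ℝ Φ p v) =
      τ (fderiv ℝ Φ p (s (β v w - β w v))) - β (Φ p) (fderiv ℝ Φ p (s (β v w - β w v))) := by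
  have h2 : (2 : WithTop ℕ∞) ≤ ∞ := WithTop.coe_le_coe.2 (le_top : (2 : ℕ∞) ≤ ⊤)
  have hcd : ContDiffAt ℝ ∞ Φ p := hΦ.contDiffAt (hU.mem_nhds hp)
  have hd : HasFDerivAt Φ (fderiv ℝ Φ p) p :=
    (hcd.differentiableAt (by simp)).hasFDerivAt
  have hdd : HasFDerivAt (fderiv ℝ Φ) (fderiv ℝ (fderiv ℝ Φ) p) p :=
    ((hcd.fderiv_right (m := 1) (one_add_one_eq_two.le.trans h2)).differentiableAt
      (by simp)).hasFDerivAt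
  have key : ∀ v w : E, τ w = β p w →
      τ (fderiv ℝ (fderiv ℝ Φ) p v w + fderiv ℝ Φ p (s (β v w))) -
        (β (Φ p) (fderiv ℝ (fderiv ℝ Φ) p v w + fderiv ℝ Φ p (s (β v w))) +
          β (fderiv ℝ Φ p v) (fderiv ℝ Φ p w)) = 0 := by
    intro v w hw
    -- Extend `w` to a field lying in the kernel at every `q`; `β` kills the range of `s`, so only
    -- the `s (β q w)` term varies. The preserved kernel condition is then differentiated along `v`.
    have hW : HasFDerivAt (fun q => w - s (τ w) + s (β q w)) (s.comp (β.flip w)) p :=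
      (s.comp (β.flip w)).hasFDerivAt.const_add _
    have hWp : w - s (τ w) + s (β p w) = w := by rw [hw]; abel
    have hy := hdd.clm_apply hW
    have hk := (τ.hasFDerivAt.comp p hy).sub ((β.hasFDerivAt.comp p hd).clm_apply hy)
    have h0 : HasFDerivAt (fun _ : E => (0 : G)) (0 : E →L[ℝ] G) p := hasFDerivAt_const _ _
    have heq := (h0.congr_of_eventuallyEq (f₁ := _) ?_).unique hk
    · have := congrArg (fun L : E →L[ℝ] G => L v) heq
      simp [hWp] at this
      simp
      rw [eq_comm]
      convert this using 1
      abel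
    · filter_upwards [hU.mem_nhds hp] with q hq
      have := hker q hq (w - s (τ w) + s (β q w)) (by simp [hτ, hβ])
      simp only [Pi.sub_apply, Function.comp_apply]
      exact sub_eq_zero.2 this
  -- Antisymmetrizing in `v`, `w` removes the second derivative of `Φ`.
  have hsymm := hcd.isSymmSndFDerivAt (by simpa using h2) v w
  have h1 := key v w hw
  have h2 := key w v hv
  rw [← hsymm] at h2
  simp only [map_add, map_sub] at h1 h2 ⊢
  rw [← sub_eq_zero]
  rw [← sub_eq_zero.2 (h2.trans h1.symm)]
  abel

/-! ### Contraction of symmetric tensors on the plane -/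

/-- The contraction of derivatives of order `n` with a vector: `j ↦ c_j h_x + c_{j+1} h_y`. -/
def contract {n : ℕ} (c : Fin (n + 1) → ℝ) (h : Fin 2 → ℝ) : Fin n → ℝ :=
  fun j => c j.castSucc * h 0 + c j.succ * h 1

theorem contract_add_left {n : ℕ} (c d : Fin (n + 1) → ℝ) (h : Fin 2 → ℝ) :
    contract (c + d) h = contract c h + contract d h := by
  ext j; simp [contract]; ring

theorem contract_smul_left {n : ℕ} (r : ℝ) (c : Fin (n + 1) → ℝ) (h : Fin 2 → ℝ) :
    contract (r • c) h = r • contract c h := by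
  ext j; simp [contract]; ring

theorem contract_add_right {n : ℕ} (c : Fin (n + 1) → ℝ) (h k : Fin 2 → ℝ) :
    contract c (h + k) = contract c h + contract c k := by
  ext j; simp [contract]; ring

theorem contract_smul_right {n : ℕ} (r : ℝ) (c : Fin (n + 1) → ℝ) (h : Fin 2 → ℝ) :
    contract c (r • h) = r • contract c h := by
  ext j; simp [contract]; ring

@[simp] theorem contract_zero_left {n : ℕ} (h : Fin 2 → ℝ) :
    contract (0 : Fin (n + 1) → ℝ) h = 0 := by
  ext j; simp [contract]

@[simp] theorem contract_zero_right {n : ℕ} (c : Fin (n + 1) → ℝ) : contract c 0 = 0 := by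
  ext j; simp [contract]

theorem contract_comm {n : ℕ} (c : Fin (n + 2) → ℝ) (h k : Fin 2 → ℝ) :
    contract (contract c h) k = contract (contract c k) h := by
  ext j; simp [contract]; ring

theorem exists_contract_eq {n : ℕ} (q : Fin n → ℝ) :
    ∃ c : Fin (n + 1) → ℝ, contract c ![1, 0] = q :=
  ⟨Fin.snoc q 0, by ext j; simp [contract]⟩

theorem eq_zero_of_contract_eq_zero {n : ℕ} {c : Fin (n + 2) → ℝ}
    (hc : ∀ h, contract c h = 0) : c = 0 := by
  ext j
  refine Fin.lastCases ?_ (fun i => ?_) j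
  · simpa [contract] using congrFun (hc ![0, 1]) (Fin.last n)
  · simpa [contract] using congrFun (hc ![1, 0]) i

/-- A nonzero vector contracts second derivatives onto all first derivatives. -/
theorem eq_zero_of_contract_mem_span {h z : Fin 2 → ℝ}
    (hz : ∀ r : Fin 3 → ℝ, ∃ c : ℝ, contract r h = c • z) : h = 0 := by
  obtain ⟨a, ha⟩ := hz ![1, 0, 0]
  obtain ⟨b, hb⟩ := hz ![0, 1, 0]
  obtain ⟨c, hc⟩ := hz ![0, 0, 1]
  have a0 := congrFun ha 0
  have a1 := congrFun ha 1
  have b0 := congrFun hb 0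
  have b1 := congrFun hb 1
  have c0 := congrFun hc 0
  have c1 := congrFun hc 1
  simp [contract] at a0 a1 b0 b1 c0 c1
  ext i
  fin_cases i
  -- Contractions lying on one line have vanishing 2×2 determinants; here the determinant is the
  -- square of a coordinate of `h`.
  · have : h 0 * h 0 = 0 := by
      calc h 0 * h 0 = (a * z 0) * (b * z 1) := by rw [← a0, ← b1]
        _ = (b * z 0) * (a * z 1) := by ring
        _ = 0 := by rcases a1 with a1 | a1 <;> simp [a1]
    simpa using this
  · have : h 1 * h 1 = 0 := by
      calc h 1 * h 1 = (b * z 0) * (c * z 1) := by rw [← b0, ← c1]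
        _ = (c * z 0) * (b * z 1) := by ring
        _ = 0 := by rcases c0 with c0 | c0 <;> simp [c0]
    simpa using this

/-! ### Jet coordinates and contact forms as bilinear data -/

/-- The third jet with the given coordinates. -/
def mkJet (h : Fin 2 → ℝ) (u : Fin 1 → ℝ) (a : Fin 2 → ℝ) (b : Fin 3 → ℝ) (c : Fin 4 → ℝ) : J3 :=
  ((((h, u), a), b), c)

section mkJet

variable (h : Fin 2 → ℝ) (u : Fin 1 → ℝ) (a : Fin 2 → ℝ) (b : Fin 3 → ℝ) (c : Fin 4 → ℝ)

@[simp] theorem base_mkJet : base (mkJet h u a b c) = h := rfl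
@[simp] theorem ord0_mkJet : ord0 (mkJet h u a b c) = u := rfl
@[simp] theorem ord1_mkJet : ord1 (mkJet h u a b c) = a := rfl
@[simp] theorem ord2_mkJet : ord2 (mkJet h u a b c) = b := rfl
@[simp] theorem ord3_mkJet : ord3 (mkJet h u a b c) = c := rfl

end mkJet

section linear

variable (v w : J3) (r : ℝ)

theorem base_add : base (v + w) = base v + base w := rfl
theorem ord0_add : ord0 (v + w) = ord0 v + ord0 w := rfl
theorem ord1_add : ord1 (v + w) = ord1 v + ord1 w := rfl
theorem ord2_add : ord2 (v + w) = ord2 v + ord2 w := rfl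
theorem ord3_add : ord3 (v + w) = ord3 v + ord3 w := rfl
theorem base_sub : base (v - w) = base v - base w := rfl
theorem ord0_sub : ord0 (v - w) = ord0 v - ord0 w := rfl
theorem ord1_sub : ord1 (v - w) = ord1 v - ord1 w := rfl
theorem ord2_sub : ord2 (v - w) = ord2 v - ord2 w := rfl
theorem base_smul : base (r • v) = r • base v := rfl
theorem ord0_smul : ord0 (r • v) = r • ord0 v := rfl
theorem ord1_smul : ord1 (r • v) = r • ord1 v := rfl
theorem ord2_smul : ord2 (r • v) = r • ord2 v := rfl
theorem ord3_smul : ord3 (r • v) = r • ord3 v := rfl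

end linear

theorem jet_ext {v w : J3} (hb : base v = base w) (h0 : ord0 v = ord0 w) (h1 : ord1 v = ord1 w)
    (h2 : ord2 v = ord2 w) (h3 : ord3 v = ord3 w) : v = w :=
  Prod.ext (Prod.ext (Prod.ext (Prod.ext hb h0) h1) h2) h3

theorem mem_cartan {p v : J3} : v ∈ cartan p ↔
    ord0 v = contract (ord1 p) (base v) ∧ ord1 v = contract (ord2 p) (base v) ∧
      ord2 v = contract (ord3 p) (base v) := by
  simp only [funext_iff]
  rfl

/-- The common kernel of the contact forms of order at most one, which is the derived
distribution of the Cartan distribution. -/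
def MemDerived (p v : J3) : Prop :=
  ord0 v = contract (ord1 p) (base v) ∧ ord1 v = contract (ord2 p) (base v)

/-- The components along `u` and its first and second derivatives. -/
noncomputable def fibrePart₂ : J3 →L[ℝ] (Fin 1 → ℝ) × (Fin 2 → ℝ) × (Fin 3 → ℝ) :=
  LinearMap.toContinuousLinearMap
    { toFun := fun v => (ord0 v, ord1 v, ord2 v)
      map_add' := fun _ _ => rfl
      map_smul' := fun _ _ => rfl }

/-- The bilinear part of the contact forms of order at most two. -/
noncomputable def contraction₂ : J3 →L[ℝ] J3 →L[ℝ] (Fin 1 → ℝ) × (Fin 2 → ℝ) × (Fin 3 → ℝ) :=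
  (LinearMap.mk₂ ℝ
    (fun p w : J3 => (contract (ord1 p) (base w), contract (ord2 p) (base w),
      contract (ord3 p) (base w)))
    (fun p q w => by simp [ord1_add, ord2_add, ord3_add, contract_add_left])
    (fun r p w => by simp [ord1_smul, ord2_smul, ord3_smul, contract_smul_left])
    (fun p v w => by simp [base_add, contract_add_right])
    (fun r p w => by simp [base_smul, contract_smul_right])).toContinuousBilinearMap

/-- The inclusion of the components along `u` and its first and second derivatives. -/
noncomputable def fibreIncl₂ : (Fin 1 → ℝ) × (Fin 2 → ℝ) × (Fin 3 → ℝ) →L[ℝ] J3 :=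
  LinearMap.toContinuousLinearMap
    { toFun := fun g => mkJet 0 g.1 g.2.1 g.2.2 0
      map_add' := fun _ _ => by
        apply jet_ext <;> simp [base_add, ord0_add, ord1_add, ord2_add, ord3_add]
      map_smul' := fun _ _ => by
        apply jet_ext <;> simp [base_smul, ord0_smul, ord1_smul, ord2_smul, ord3_smul] }

/-- The components along `u` and its first derivatives. -/
noncomputable def fibrePart₁ : J3 →L[ℝ] (Fin 1 → ℝ) × (Fin 2 → ℝ) :=
  LinearMap.toContinuousLinearMap
    { toFun := fun v => (ord0 v, ord1 v)
      map_add' := fun _ _ => rfl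
      map_smul' := fun _ _ => rfl }

/-- The bilinear part of the contact forms of order at most one. -/
noncomputable def contraction₁ : J3 →L[ℝ] J3 →L[ℝ] (Fin 1 → ℝ) × (Fin 2 → ℝ) :=
  (LinearMap.mk₂ ℝ
    (fun p w : J3 => (contract (ord1 p) (base w), contract (ord2 p) (base w)))
    (fun p q w => by simp [ord1_add, ord2_add, contract_add_left])
    (fun r p w => by simp [ord1_smul, ord2_smul, contract_smul_left])
    (fun p v w => by simp [base_add, contract_add_right])
    (fun r p w => by simp [base_smul, contract_smul_right])).toContinuousBilinearMap

/-- The inclusion of the components along `u` and its first derivatives. -/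
noncomputable def fibreIncl₁ : (Fin 1 → ℝ) × (Fin 2 → ℝ) →L[ℝ] J3 :=
  LinearMap.toContinuousLinearMap
    { toFun := fun g => mkJet 0 g.1 g.2 0 0
      map_add' := fun _ _ => by
        apply jet_ext <;> simp [base_add, ord0_add, ord1_add, ord2_add, ord3_add]
      map_smul' := fun _ _ => by
        apply jet_ext <;> simp [base_smul, ord0_smul, ord1_smul, ord2_smul, ord3_smul] }

@[simp] theorem fibrePart₂_apply (v : J3) : fibrePart₂ v = (ord0 v, ord1 v, ord2 v) := rfl

@[simp] theorem contraction₂_apply (p w : J3) : contraction₂ p w =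
    (contract (ord1 p) (base w), contract (ord2 p) (base w), contract (ord3 p) (base w)) := rfl

@[simp] theorem fibreIncl₂_apply (g : (Fin 1 → ℝ) × (Fin 2 → ℝ) × (Fin 3 → ℝ)) :
    fibreIncl₂ g = mkJet 0 g.1 g.2.1 g.2.2 0 := rfl

@[simp] theorem fibrePart₁_apply (v : J3) : fibrePart₁ v = (ord0 v, ord1 v) := rfl

@[simp] theorem contraction₁_apply (p w : J3) : contraction₁ p w =
    (contract (ord1 p) (base w), contract (ord2 p) (base w)) := rfl

@[simp] theorem fibreIncl₁_apply (g : (Fin 1 → ℝ) × (Fin 2 → ℝ)) :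
    fibreIncl₁ g = mkJet 0 g.1 g.2 0 0 := rfl

theorem mem_cartan_iff {p v : J3} : v ∈ cartan p ↔ fibrePart₂ v = contraction₂ p v := by
  rw [mem_cartan]
  simp [Prod.ext_iff]

theorem memDerived_iff {p v : J3} : MemDerived p v ↔ fibrePart₁ v = contraction₁ p v := by
  simp [MemDerived, Prod.ext_iff]

/-! ### Contact transformations and the derived distribution -/

namespace IsContactTransformation

variable {Φ : OpenPartialHomeomorph J3 J3}

theorem hasFDerivAt (hΦ : IsContactTransformation Φ) {p : J3} (hp : p ∈ Φ.source) :
    HasFDerivAt Φ (fderiv ℝ Φ p) p :=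
  ((hΦ.contDiffOn.contDiffAt (Φ.open_source.mem_nhds hp)).differentiableAt
    (by simp)).hasFDerivAt

theorem fderiv_symm_fderiv (hΦ : IsContactTransformation Φ) {p : J3} (hp : p ∈ Φ.source) (v : J3) :
    fderiv ℝ Φ.symm (Φ p) (fderiv ℝ Φ p v) = v := by
  have hq : Φ p ∈ Φ.target := Φ.map_source hp
  have h2 : HasFDerivAt Φ.symm (fderiv ℝ Φ.symm (Φ p)) (Φ p) :=
    ((hΦ.contDiffOn_symm.contDiffAt (Φ.open_target.mem_nhds hq)).differentiableAt
      (by simp)).hasFDerivAt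
  have h := (h2.comp p (hΦ.hasFDerivAt hp)).unique
    ((hasFDerivAt_id p).congr_of_eventuallyEq (Φ.eventually_left_inverse hp))
  exact congrArg (fun L : J3 →L[ℝ] J3 => L v) h

theorem symm (hΦ : IsContactTransformation Φ) : IsContactTransformation Φ.symm where
  contDiffOn := hΦ.contDiffOn_symm
  contDiffOn_symm := by simpa using hΦ.contDiffOn
  map_cartan := by
    intro q hq
    have hp : Φ.symm q ∈ Φ.source := Φ.map_target hq
    have h := hΦ.map_cartan _ hp
    have hi := hΦ.fderiv_symm_fderiv hp
    rw [Φ.right_inv hq] at h hi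
    rw [← h, ← Submodule.map_comp]
    convert Submodule.map_id _
    exact LinearMap.ext hi

theorem fderiv_fderiv_symm (hΦ : IsContactTransformation Φ) {p : J3} (hp : p ∈ Φ.source) (v : J3) :
    fderiv ℝ Φ p (fderiv ℝ Φ.symm (Φ p) v) = v := by
  have h := hΦ.symm.fderiv_symm_fderiv (p := Φ p) (Φ.map_source hp) v
  rwa [Φ.symm_symm, Φ.left_inv hp] at h

theorem fderiv_mem_cartan (hΦ : IsContactTransformation Φ) {p : J3} (hp : p ∈ Φ.source) {v : J3}
    (hv : v ∈ cartan p) : fderiv ℝ Φ p v ∈ cartan (Φ p) := by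
  rw [← hΦ.map_cartan p hp]
  exact ⟨v, hv, rfl⟩

/-- A derived vector is a Cartan vector plus a curvature value of two Cartan vectors, and curvature
is natural under `Φ`. -/
theorem memDerived_fderiv (hΦ : IsContactTransformation Φ) {p : J3} (hp : p ∈ Φ.source) {v : J3}
    (hv : MemDerived p v) : MemDerived (Φ p) (fderiv ℝ Φ p v) := by
  -- `c` is chosen so that the curvature of the vertical `a` and the horizontal `b` is `g`, the
  -- second-order defect of `v` from the Cartan plane.
  obtain ⟨c, hc⟩ := exists_contract_eq (ord2 v - contract (ord3 p) (base v))
  set e : Fin 2 → ℝ := ![1, 0]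
  let a : J3 := mkJet 0 0 0 0 c
  let b : J3 := mkJet e (contract (ord1 p) e) (contract (ord2 p) e) (contract (ord3 p) e) 0
  let g : J3 := mkJet 0 0 0 (contract c e) 0
  have ha : a ∈ cartan p := by simp [mem_cartan, a]
  have hb : b ∈ cartan p := by simp [mem_cartan, b]
  have hg : v - g ∈ cartan p := by
    rw [mem_cartan]
    simp [g, hc, ord0_sub, ord1_sub, ord2_sub, base_sub, hv.1, hv.2]
  have key := curvature_map fibrePart₂ contraction₂ fibreIncl₂ (fun _ => rfl)
    (fun p g => by simp) Φ.open_source hΦ.contDiffOn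
    (fun p hp w hw => mem_cartan_iff.1 (hΦ.fderiv_mem_cartan hp (mem_cartan_iff.2 hw))) hp
    (mem_cartan_iff.1 ha) (mem_cartan_iff.1 hb)
  have hgi : fibreIncl₂ (contraction₂ a b - contraction₂ b a) = g := by
    simp [a, b, g]
  rw [hgi] at key
  have hm : ∀ w ∈ cartan (Φ p), MemDerived (Φ p) w := fun w hw =>
    ⟨(mem_cartan.1 hw).1, (mem_cartan.1 hw).2.1⟩
  have hda := mem_cartan.1 (hΦ.fderiv_mem_cartan hp ha)
  have hdb := mem_cartan.1 (hΦ.fderiv_mem_cartan hp hb)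
  have hdg : MemDerived (Φ p) (fderiv ℝ Φ p g) := by
    -- Both images are Cartan, so these components of their curvature are double contractions of a
    -- single tensor and cancel by symmetry.
    have k0 := congrArg Prod.fst key
    have k1 := congrArg (fun x => x.2.1) key
    simp at k0 k1
    rw [hda.2.1, hdb.2.1, contract_comm, sub_self, eq_comm, sub_eq_zero] at k0
    rw [hda.2.2, hdb.2.2, contract_comm, sub_self, eq_comm, sub_eq_zero] at k1
    exact ⟨k0, k1⟩
  have := hm _ (hΦ.fderiv_mem_cartan hp hg)
  rw [memDerived_iff] at this hdg ⊢
  rw [← sub_add_cancel v g, map_add, map_add, map_add, this, hdg]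

/-- Curvature of the derived distribution. -/
theorem curvature_derived (hΦ : IsContactTransformation Φ) {p : J3} (hp : p ∈ Φ.source) {v w : J3}
    (hv : MemDerived p v) (hw : MemDerived p w) :
    contraction₁ (fderiv ℝ Φ p v) (fderiv ℝ Φ p w) -
        contraction₁ (fderiv ℝ Φ p w) (fderiv ℝ Φ p v) =
      (fibrePart₁ - contraction₁ (Φ p))
        (fderiv ℝ Φ p (fibreIncl₁ (contraction₁ v w - contraction₁ w v))) :=
  curvature_map fibrePart₁ contraction₁ fibreIncl₁ (fun _ => rfl)
    (fun p g => by simp) Φ.open_source hΦ.contDiffOn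
    (fun _ hp _ hw => memDerived_iff.1 (hΦ.memDerived_fderiv hp (memDerived_iff.2 hw))) hp
    (memDerived_iff.1 hv) (memDerived_iff.1 hw)

/-- Curvature pairings with `v` all lie on the line through `(0, z)`. If the image had nonzero base
part, its pairings with vertical second-order vectors would fill a plane. -/
theorem base_fderiv_of_rank_one (hΦ : IsContactTransformation Φ) {p : J3} (hp : p ∈ Φ.source)
    {v : J3} (hb : base v = 0) (h0 : ord0 v = 0) (h1 : ord1 v = 0) {z : Fin 2 → ℝ}
    (hz : ∀ h, ∃ c : ℝ, contract (ord2 v) h = c • z) : base (fderiv ℝ Φ p v) = 0 := by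
  have hv : MemDerived p v := by simp [MemDerived, hb, h0, h1]
  refine eq_zero_of_contract_mem_span
    (z := ((fibrePart₁ - contraction₁ (Φ p)) (fderiv ℝ Φ p (fibreIncl₁ (0, z)))).2) fun r => ?_
  let w' : J3 := mkJet 0 0 0 r 0
  have hw' : MemDerived (Φ p) w' := by simp [MemDerived, w']
  have hw : MemDerived p (fderiv ℝ Φ.symm (Φ p) w') := by
    have := hΦ.symm.memDerived_fderiv (p := Φ p) (Φ.map_source hp) hw'
    rwa [Φ.left_inv hp] at this
  have key := hΦ.curvature_derived hp hw hv
  rw [hΦ.fderiv_fderiv_symm hp] at key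
  obtain ⟨c, hc⟩ := hz (base (fderiv ℝ Φ.symm (Φ p) w'))
  have hcz : contraction₁ (fderiv ℝ Φ.symm (Φ p) w') v -
      contraction₁ v (fderiv ℝ Φ.symm (Φ p) w') = (-c) • ((0 : Fin 1 → ℝ), z) := by
    simp [hb, h1, hc]
  rw [hcz, map_smul, map_smul, map_smul] at key
  refine ⟨-c, ?_⟩
  have := congrArg Prod.snd key
  simpa [w'] using this

/-- The base coordinates of a contact transformation of `J³` only depend on the first jet. -/
theorem base_fderiv_eq_zero (hΦ : IsContactTransformation Φ) {p : J3} (hp : p ∈ Φ.source)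
    {v : J3} (hb : base v = 0) (h0 : ord0 v = 0) (h1 : ord1 v = 0) :
    base (fderiv ℝ Φ p v) = 0 := by
  -- Binary quadratic forms are spanned by the squares of $\xi$, $\xi+\eta$, $\eta$, each of rank
  -- one; the third-order part may ride on any summand.
  have e : v = mkJet 0 0 0 ![ord2 v 0 - ord2 v 1, 0, 0] (ord3 v) +
      mkJet 0 0 0 ![ord2 v 1, ord2 v 1, ord2 v 1] 0 +
      mkJet 0 0 0 ![0, 0, ord2 v 2 - ord2 v 1] 0 := by
    apply jet_ext
    · simp [base_add, hb]
    · simp [ord0_add, h0]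
    · simp [ord1_add, h1]
    · ext i; fin_cases i <;> simp [ord2_add]
    · simp [ord3_add]
  rw [e, map_add, map_add, base_add, base_add,
    hΦ.base_fderiv_of_rank_one hp (z := ![1, 0]) rfl rfl rfl,
    hΦ.base_fderiv_of_rank_one hp (z := ![1, 1]) rfl rfl rfl,
    hΦ.base_fderiv_of_rank_one hp (z := ![0, 1]) rfl rfl rfl]
  · simp
  · intro h
    refine ⟨(ord2 v 2 - ord2 v 1) * h 1, ?_⟩
    ext i; fin_cases i <;> simp [contract]
  · intro h
    refine ⟨ord2 v 1 * h 0 + ord2 v 1 * h 1, ?_⟩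
    ext i; fin_cases i <;> simp [contract]
  · intro h
    refine ⟨(ord2 v 0 - ord2 v 1) * h 0, ?_⟩
    ext i; fin_cases i <;> simp [contract]

/-- A vector tangent to the fibre is Cartan, and a Cartan vector with zero base part is again
tangent to the fibre. -/
theorem proj_fderiv_eq_zero (hΦ : IsContactTransformation Φ) {p : J3} (hp : p ∈ Φ.source)
    {v : J3} (hv : proj v = 0) : proj (fderiv ℝ Φ p v) = 0 := by
  obtain ⟨w, c⟩ := v
  obtain rfl : w = 0 := hv
  have hb := hΦ.base_fderiv_eq_zero hp (v := (0, c)) rfl rfl rfl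
  have hc : ((0, c) : J3) ∈ cartan p := by simp [mem_cartan, base, ord0, ord1, ord2]
  obtain ⟨h0, h1, h2⟩ := mem_cartan.1 (hΦ.fderiv_mem_cartan hp hc)
  rw [hb, contract_zero_right] at h0 h1 h2
  exact Prod.ext (Prod.ext (Prod.ext hb h0) h1) h2

/-! ### Behaviour along the fibres of $J^3\to J^2$ -/

/-- Near each point, a contact transformation of `J³` maps fibres of `J³ → J²` to fibres. -/
theorem proj_eq_of_mem_ball (hΦ : IsContactTransformation Φ) {p₀ : J3} {r : ℝ}
    (hr : Metric.ball p₀ r ⊆ Φ.source) {p q : J3} (hp : p ∈ Metric.ball p₀ r)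
    (hq : q ∈ Metric.ball p₀ r) (hpq : proj p = proj q) : proj (Φ p) = proj (Φ q) := by
  let γ : ℝ → J3 := fun t => p + t • (q - p)
  have hγ : ∀ t, HasDerivAt γ (q - p) t := fun t => by
    simpa [γ] using ((hasDerivAt_id t).smul_const (q - p)).const_add p
  have hmem : ∀ t ∈ Set.Icc (0 : ℝ) 1, γ t ∈ Φ.source := fun t ht =>
    hr ((convex_ball p₀ r).add_smul_sub_mem hp hq ht)
  have hv : proj (q - p) = 0 := sub_eq_zero.2 hpq.symm
  have hder : ∀ t ∈ Set.Icc (0 : ℝ) 1, HasDerivAt (fun t => proj (Φ (γ t))) 0 t := by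
    intro t ht
    have h := (hΦ.hasFDerivAt (hmem t ht)).comp_hasDerivAt t (hγ t)
    have h' := (ContinuousLinearMap.fst ℝ J2 (Fin 4 → ℝ)).hasFDerivAt.comp_hasDerivAt t h
    have hz := hΦ.proj_fderiv_eq_zero (hmem t ht) hv
    change HasDerivAt (fun t => proj (Φ (γ t))) (proj (fderiv ℝ Φ (γ t) (q - p))) t at h'
    rwa [hz] at h'
  have := constant_of_has_deriv_right_zero (f := fun t => proj (Φ (γ t))) (a := 0) (b := 1)
    (fun t ht => (hder t ht).continuousAt.continuousWithinAt)
    (fun t ht => (hder t (Set.Ico_subset_Icc_self ht)).hasDerivWithinAt) 1 (by simp)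
  simpa [γ] using this.symm

theorem proj_fderiv_eq_of_mem_ball (hΦ : IsContactTransformation Φ) {p₀ : J3} {r : ℝ}
    (hr : Metric.ball p₀ r ⊆ Φ.source) {p q : J3} (hp : p ∈ Metric.ball p₀ r)
    (hq : q ∈ Metric.ball p₀ r) (hpq : proj p = proj q) (v : J3) :
    proj (fderiv ℝ Φ p v) = proj (fderiv ℝ Φ q v) := by
  have hd : ∀ p ∈ Metric.ball p₀ r, HasDerivAt (fun t : ℝ => proj (Φ (p + t • v)))
      (proj (fderiv ℝ Φ p v)) 0 := by
    intro p hp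
    have hγ : HasDerivAt (fun t : ℝ => p + t • v) v 0 := by
      simpa using ((hasDerivAt_id (0 : ℝ)).smul_const v).const_add p
    have hf : HasFDerivAt Φ (fderiv ℝ Φ p) (p + (0 : ℝ) • v) := by
      simpa using hΦ.hasFDerivAt (hr hp)
    exact (ContinuousLinearMap.fst ℝ J2 (Fin 4 → ℝ)).hasFDerivAt.comp_hasDerivAt 0
      (hf.comp_hasDerivAt 0 hγ)
  have hev : ∀ p ∈ Metric.ball p₀ r, ∀ᶠ t : ℝ in nhds 0, p + t • v ∈ Metric.ball p₀ r := by
    intro p hp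
    have hc : ContinuousAt (fun t : ℝ => p + t • v) 0 := by fun_prop
    exact hc.eventually_mem (by simpa using Metric.isOpen_ball.mem_nhds hp)
  refine ((hd p hp).congr_of_eventuallyEq ?_).unique (hd q hq)
  filter_upwards [hev p hp, hev q hq] with t htp htq
  refine hΦ.proj_eq_of_mem_ball hr htq htp ?_
  change proj q + proj (t • v) = proj p + proj (t • v)
  rw [hpq]

/-- Near each point, a contact transformation of `J³` is affine on the fibres of `J³ → J²`. -/
theorem ord3_midpoint (hΦ : IsContactTransformation Φ) {p₀ : J3} {r : ℝ}
    (hr : Metric.ball p₀ r ⊆ Φ.source) {p q m : J3} (hp : p ∈ Metric.ball p₀ r)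
    (hq : q ∈ Metric.ball p₀ r) (hm : m ∈ Metric.ball p₀ r)
    (hpm : proj p = proj m) (hqm : proj q = proj m)
    (h3 : ord3 p + ord3 q = (2 : ℝ) • ord3 m) :
    ord3 (Φ p) + ord3 (Φ q) = (2 : ℝ) • ord3 (Φ m) := by
  -- The horizontal Cartan vector at `p` over `h`, which is affine in `ord3 p`. Since the `J2` part
  -- of the differential is constant on the fibre, all these vectors can be pushed forward at `m`.
  let lift : J3 → (Fin 2 → ℝ) → J3 := fun p h =>
    mkJet h (contract (ord1 m) h) (contract (ord2 m) h) (contract (ord3 p) h) 0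
  have hlift : ∀ p, proj p = proj m → ∀ h, lift p h ∈ cartan p := by
    intro p hpm h
    have e1 : ord1 p = ord1 m := congrArg (fun x : J2 => x.1.2) hpm
    have e2 : ord2 p = ord2 m := congrArg (fun x : J2 => x.2) hpm
    simp [mem_cartan, lift, e1, e2]
  have hbase : ∀ p h, base (fderiv ℝ Φ m (lift p h)) = base (fderiv ℝ Φ m (lift m h)) := by
    intro p h
    rw [← sub_eq_zero, ← base_sub, ← map_sub]
    exact hΦ.base_fderiv_eq_zero (hr hm) (sub_self _) (sub_self _) (sub_self _)
  have hrel : ∀ p ∈ Metric.ball p₀ r, proj p = proj m → ∀ h, ord2 (fderiv ℝ Φ m (lift p h)) =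
      contract (ord3 (Φ p)) (base (fderiv ℝ Φ m (lift m h))) := by
    intro p hp hpm h
    have hc := (mem_cartan.1 (hΦ.fderiv_mem_cartan (hr hp) (hlift p hpm h))).2.2
    have e := hΦ.proj_fderiv_eq_of_mem_ball hr hp hm hpm (lift p h)
    have eb : base (fderiv ℝ Φ p (lift p h)) = base (fderiv ℝ Φ m (lift p h)) :=
      congrArg (fun x : J2 => x.1.1.1) e
    have e2 : ord2 (fderiv ℝ Φ p (lift p h)) = ord2 (fderiv ℝ Φ m (lift p h)) :=
      congrArg (fun x : J2 => x.2) e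
    rw [← e2, hc, eb, hbase]
  have hsum : ∀ h, lift p h + lift q h = (2 : ℝ) • lift m h := by
    intro h
    apply jet_ext
    · simp [base_add, lift, two_smul]
    · simp [ord0_add, lift, two_smul]
    · simp [ord1_add, lift, two_smul]
    · simp [ord2_add, ord2_smul, lift, ← contract_add_left, ← contract_smul_left, h3]
    · simp [ord3_add, ord3_smul, lift]
  rw [← sub_eq_zero]
  refine eq_zero_of_contract_eq_zero fun e => ?_
  -- Every base direction at `Φ m` is reached: pull back a horizontal vector by the inverse;
  -- replacing it by its lift changes only components of order at least two.
  obtain ⟨h, rfl⟩ : ∃ h, base (fderiv ℝ Φ m (lift m h)) = e := by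
    let w' : J3 := mkJet e (contract (ord1 (Φ m)) e) (contract (ord2 (Φ m)) e)
      (contract (ord3 (Φ m)) e) 0
    have hw' : MemDerived (Φ m) w' := by simp [MemDerived, w']
    have hw := hΦ.symm.memDerived_fderiv (p := Φ m) (Φ.map_source (hr hm)) hw'
    rw [Φ.left_inv (hr hm)] at hw
    refine ⟨base (fderiv ℝ Φ.symm (Φ m) w'), ?_⟩
    have : base (fderiv ℝ Φ m (fderiv ℝ Φ.symm (Φ m) w')) = e := by
      rw [hΦ.fderiv_fderiv_symm (hr hm)]; rfl
    rw [← this, ← sub_eq_zero, ← base_sub, ← map_sub]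
    refine hΦ.base_fderiv_eq_zero (hr hm) (sub_self _) ?_ ?_
    · rw [ord0_sub, hw.1]; exact sub_self _
    · rw [ord1_sub, hw.2]; exact sub_self _
  have key : ord2 (fderiv ℝ Φ m (lift p h + lift q h)) =
      ord2 (fderiv ℝ Φ m ((2 : ℝ) • lift m h)) := by rw [hsum]
  rw [map_add, map_smul, ord2_add, ord2_smul, hrel p hp hpm, hrel q hq hqm, hrel m hm rfl,
    ← contract_add_left, ← contract_smul_left] at key
  rw [sub_eq_add_neg, contract_add_left, key, ← contract_add_left, add_neg_cancel,
    contract_zero_left]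

end IsContactTransformation

/-! ### Midpoints in quasi-linear equations and in the cone -/

/-- The intersection of a quasi-linear equation with a fibre of `J³ → J²` is closed under
midpoints. -/
theorem IsQuasiLinear.mem_of_midpoint {F : Set J3} (hF : IsQuasiLinear F) {p q m : J3}
    (hp : p ∈ F) (hq : q ∈ F) (hpm : proj p = proj m) (hqm : proj q = proj m)
    (h3 : ord3 p + ord3 q = (2 : ℝ) • ord3 m) : m ∈ F := by
  obtain ⟨W, a, b, -, -, -, rfl⟩ := hF
  obtain ⟨hpW, hp⟩ := hp
  obtain ⟨-, hq⟩ := hq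
  rw [hpm] at hpW hp
  rw [hqm] at hq
  refine ⟨hpW, ?_⟩
  have h : ∀ j, ord3 p j + ord3 q j = 2 * ord3 m j := fun j => by simpa using congrFun h3 j
  simp only [Fin.sum_univ_four] at hp hq ⊢
  linear_combination (1 / 2 : ℝ) * hp + (1 / 2 : ℝ) * hq - (1 / 2 : ℝ) * a 0 (proj m) * h 0 -
    (1 / 2 : ℝ) * a 1 (proj m) * h 1 - (1 / 2 : ℝ) * a 2 (proj m) * h 2 -
    (1 / 2 : ℝ) * a 3 (proj m) * h 3

/-- Every point of the quadratic cone is a limit of curves of points of the cone, whose midpoints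
lie off the cone. -/
theorem exists_curves_equationE {p : J3} (hp : p ∈ equationE) :
    ∃ f g : ℝ → Fin 4 → ℝ, Continuous f ∧ Continuous g ∧ f 0 = ord3 p ∧ g 0 = ord3 p ∧
      ∀ ε ≠ 0, f ε 1 * f ε 3 - f ε 2 ^ 2 = 0 ∧ g ε 1 * g ε 3 - g ε 2 ^ 2 = 0 ∧
        (f ε 1 + g ε 1) * (f ε 3 + g ε 3) - (f ε 2 + g ε 2) ^ 2 ≠ 0 := by
  have hE : ord3 p 1 * ord3 p 3 - ord3 p 2 ^ 2 = 0 := hp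
  by_cases h1 : ord3 p 1 = 0
  · have h2 : ord3 p 2 = 0 := by simpa [h1] using hE
    by_cases h3 : ord3 p 3 = 0
    -- At a singular point, move along two distinct rulings of the cone.
    · refine ⟨fun ε => ![ord3 p 0, ε, 0, 0], fun ε => ![ord3 p 0, 0, 0, ε], by fun_prop,
        by fun_prop, ?_, ?_, fun ε hε => ?_⟩
      · ext i; fin_cases i <;> simp [h1, h2, h3]
      · ext i; fin_cases i <;> simp [h1, h2, h3]
      · simp [hε]
    -- Away from the singular points, fix a nonzero one of $u_{xxy}$, $u_{yyy}$; the cone is then a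
    -- parabola over $u_{xyy}$, and chords of a parabola leave it.
    · refine ⟨fun _ => ord3 p, fun ε => ![ord3 p 0, ε ^ 2 / ord3 p 3, ε, ord3 p 3],
        by fun_prop, by fun_prop, rfl, ?_, fun ε hε => ⟨hE, ?_, ?_⟩⟩
      · ext i; fin_cases i <;> simp [h1, h2]
      · simp [h3]
      · have : ε ^ 2 / ord3 p 3 * (ord3 p 3 + ord3 p 3) - ε ^ 2 = ε ^ 2 := by field_simp; ring
        simp [h1, h2, this, hε]
  · refine ⟨fun _ => ord3 p, fun ε => ![ord3 p 0, ord3 p 1, ord3 p 2 + ε,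
        (ord3 p 2 + ε) ^ 2 / ord3 p 1], by fun_prop, by fun_prop, rfl, ?_,
      fun ε hε => ⟨hE, ?_, ?_⟩⟩
    · ext i
      fin_cases i <;> simp
      field_simp
      linear_combination -hE
    · simp [mul_div_cancel₀, h1]
    · have : (ord3 p 1 + ord3 p 1) * (ord3 p 3 + (ord3 p 2 + ε) ^ 2 / ord3 p 1) -
          (ord3 p 2 + (ord3 p 2 + ε)) ^ 2 = ε ^ 2 := by
        field_simp
        linear_combination 2 * hE
      simp [this, hε]

end JetPDE

open JetPDE in
theorem mainTheorem5 :
    ¬ ∃ F : Set JetPDE.J3, JetPDE.IsQuasiLinear F ∧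
      JetPDE.ContactEquivalent JetPDE.equationE F := by
  rintro ⟨F, hF, Φ, hΦ, ⟨p, hpU, hpE⟩, himg⟩
  obtain ⟨r, hr0, hr⟩ := Metric.isOpen_iff.1 Φ.open_source p hpU
  obtain ⟨f, g, hf, hg, f0, g0, h⟩ := exists_curves_equationE hpE
  let P : (Fin 4 → ℝ) → J3 := fun c => (proj p, c)
  have hP : Continuous P := by fun_prop
  have hPp : P (ord3 p) = p := rfl
  have hball : Metric.ball p r ∈ nhds p := Metric.ball_mem_nhds p hr0
  have ef : ∀ᶠ ε in nhds (0 : ℝ), P (f ε) ∈ Metric.ball p r :=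
    (hP.comp hf).continuousAt.eventually_mem (by simpa [f0, hPp] using hball)
  have eg : ∀ᶠ ε in nhds (0 : ℝ), P (g ε) ∈ Metric.ball p r :=
    (hP.comp hg).continuousAt.eventually_mem (by simpa [g0, hPp] using hball)
  obtain ⟨ε, ⟨hfε, hgε⟩, hε⟩ := (((ef.and eg).filter_mono nhdsWithin_le_nhds).and
    (self_mem_nhdsWithin : {(0 : ℝ)}ᶜ ∈ nhdsWithin 0 {0}ᶜ)).exists
  obtain ⟨hfE, hgE, hmE⟩ := h ε hε
  let m : J3 := P ((1 / 2 : ℝ) • (f ε + g ε))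
  have hm : m ∈ Metric.ball p r := by
    have := (convex_ball p r) hfε hgε (a := 1 / 2) (b := 1 / 2) (by norm_num) (by norm_num)
      (by norm_num)
    convert this using 1
    refine Prod.ext ?_ (smul_add _ _ _)
    change proj p = (1 / 2 : ℝ) • proj p + (1 / 2 : ℝ) • proj p
    rw [← add_smul]; norm_num
  have h3 : ord3 (P (f ε)) + ord3 (P (g ε)) = (2 : ℝ) • ord3 m := by
    change f ε + g ε = (2 : ℝ) • ((1 / 2 : ℝ) • (f ε + g ε))
    rw [smul_smul]; norm_num
  have hF' : ∀ q ∈ Metric.ball p r, q ∈ equationE → Φ q ∈ F := fun q hq hqE =>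
    (himg.subset ⟨q, ⟨hr hq, hqE⟩, rfl⟩).2
  have hmF : Φ m ∈ F := hF.mem_of_midpoint (hF' _ hfε hfE) (hF' _ hgε hgE)
    (hΦ.proj_eq_of_mem_ball hr hfε hm rfl) (hΦ.proj_eq_of_mem_ball hr hgε hm rfl)
    (hΦ.ord3_midpoint hr hfε hgε hm rfl rfl h3)
  -- Equality of the image with the target part of `F`, together with injectivity, brings the
  -- midpoint back into the cone.
  obtain ⟨q, ⟨hqU, hqE⟩, hqm⟩ := himg.superset ⟨Φ.map_source (hr hm), hmF⟩
  rw [Φ.injOn hqU (hr hm) hqm] at hqE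
  apply hmE
  have : (1 / 2 * (f ε 1 + g ε 1)) * (1 / 2 * (f ε 3 + g ε 3)) -
    (1 / 2 * (f ε 2 + g ε 2)) ^ 2 = 0 := hqE
  linear_combination 4 * this
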